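/- Let $\mathbb X,\mathbb Y,\mathbb Z,\mathbb S$ be finite non-empty sets. A type on a finite set is the empirical distribution of a finite non-empty sequence of its elements, that is, a probability mass function with rational values. For $a\in\mathbb X$, $s\in\mathbb S$ let $p_{Y,Z|X,S}(\cdot,\cdot|a,s)$ be a conditional type on $\mathbb Y\times\mathbb Z$ (a conditional probability mass function with rational values), and let $Q$ be a type on $\mathbb Z$. This describes a compound discrete memoryless channel: the state $s$ is unknown to encoder and decoder and fixed during the whole block; on input $x^n$ the outputs $(y^n,z^n)$ have probability $\prod_{i=1}^n p_{Y,Z|X,S}(y_i,z_i|x_i,s)$. Write $J_s(b|a)=\sum_{c}p_{Y,Z|X,S}(b,c|a,s)$ and $K_s(c|a)=\sum_{b}p_{Y,Z|X,S}(b,c|a,s)$ for its marginals, and $V(P,P')=\sum_c|P(c)-P'(c)|$. A $(2^{nR},n)$-code consists of an encoder $\{1,\dots,\lceil 2^{nR}\rceil\}\to\mathbb X^n$ and a decoder $\mathbb Y^n\to\{1,\dots,\lceil 2^{nR}\rceil\}$; the message $M$ is uniformly distributed and $\hat M$ is the decoded message. A rate $R\ge 0$ is $(\Delta_s)_{s\in\mathbb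 S}$-achievable with interference type $Q$ if for every $\epsilon>0$ there is an $n_0$ such that for every $n>n_0$ there is a $(2^{nR},n)$-code with $\max_{s}\Pr(\hat M\ne M\mid s)<\epsilon$ and $\mathbb E_s\{V(Q,P_{z^n})\}\le\Delta_s$ for all $s$, where $\Pr(\cdot\mid s)$ and $\mathbb E_s$ refer to the channel state $s$ and $P_{z^n}$ is the type of the sequence $z^n$. Let $R^I(Q)\subseteq\mathbb R\times\mathbb R^{\mathbb S}$ be the closure of the set of all $(R,(\Delta_s)_s)$ such that $R\ge0$ is $(\Delta_s)_s$-achievable with interference type $Q$. For $\Delta\in\mathbb R^{\mathbb S}$ let $\mathcal N(\Delta)$ be the intersection over $s\in\mathbb S$ of the $\Delta_s$-pre-images of $Q$ under $K_s$, i.e. the set of all types $N$ on $\mathbb X$ such that for every $s$ the type $\sum_{a}N(a)K_s(\cdot|a)$ satisfies $V\big(Q,\sum_{a}N(a)K_s(\cdot|a)\big)\le\Delta_s$. Then $$R^I(Q)=\mathbf{Cl}\Big\{(R,(\Delta_s)_{s}):\ \mathcal N(\Delta)\neq\emptyset,\ 0\le R\le\sup_{N\in\mathcal N(\Delta)}\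 \min_{s\in\mathbb S} I(NJ_s)\Big\},$$ where $NJ_s$ is the joint distribution $N(a)J_s(b|a)$ on $\mathbb X\times\mathbb Y$ and $I$ is the mutual information in bits (logarithms to base $2$). -/

import Mathlib

open scoped BigOperators

noncomputable section

namespace InterferenceCoordination

/-! Types (empirical distributions) and conditional types over finite alphabets. A type and a
probability mass function are both represented by their real-valued function of values, so that a
matching PMF of a type is the same function. -/

/-- The type of a length-`n` sequence: relative frequency of each symbol. -/
def typeOf {A : Type*} [DecidableEq A] {n : ℕ} (x : Fin n → A) (a : A) : ℝ :=
  ((Finset.univ.filter fun i => x i = a).card : ℝ) / n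

/-- The set of all types on `A`, of any denominator `n ≥ 1`. -/
def types (A : Type*) [DecidableEq A] : Set (A → ℝ) :=
  {P | ∃ n : ℕ, 1 ≤ n ∧ ∃ x : Fin n → A, P = typeOf x}

/-- The set of all conditional types on `B` given `A`: the functions `J(b|a)` (written `J a b`) that
arise as `N(a,b|x,y) / N(a|x)` from sequences `x`, `y` of a common length `n ≥ 1`
in which every symbol `a` occurs in `x`. -/
def condTypes (A B : Type*) [DecidableEq A] [DecidableEq B] : Set (A → B → ℝ) :=
  {J | ∃ n : ℕ, 1 ≤ n ∧ ∃ (x : Fin n → A) (y : Fin n → B),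
    (∀ a, 0 < (Finset.univ.filter fun i => x i = a).card) ∧
    ∀ a b, J a b =
      ((Finset.univ.filter fun i => x i = a ∧ y i = b).card : ℝ) /
        ((Finset.univ.filter fun i => x i = a).card : ℝ)}

/-- Variational distance (without a factor one half). -/
def varDist {A : Type*} [Fintype A] (P Q : A → ℝ) : ℝ := ∑ a, |P a - Q a|

/-- The `Δ`-neighborhood of a type. -/
def neighborhood {A : Type*} [Fintype A] [DecidableEq A] (Δ : ℝ) (Q : A → ℝ) : Set (A → ℝ) :=
  {P | P ∈ types A ∧ varDist Q P ≤ Δ}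

/-- The `Δ`-pre-image of a type `Q` under a conditional type `J`. -/
def deltaPreimage {A B : Type*} [Fintype A] [DecidableEq A] [Fintype B] [DecidableEq B]
    (Δ : ℝ) (Q : B → ℝ) (J : A → B → ℝ) : Set (A → ℝ) :=
  {P | P ∈ types A ∧ (fun b => ∑ a, P a * J a b) ∈ neighborhood Δ Q}

/-- The joint type `N J`. -/
def jointType {A B : Type*} (P : A → ℝ) (J : A → B → ℝ) : A × B → ℝ :=
  fun ab => P ab.1 * J ab.1 ab.2

/-- Mutual information in bits: the relative entropy between `P` and the product of its marginals.
Terms with `P (a, b) = 0` vanish. -/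
def mutualInfo {A B : Type*} [Fintype A] [Fintype B] (P : A × B → ℝ) : ℝ :=
  ∑ a, ∑ b, P (a, b) *
    Real.logb 2 (P (a, b) / ((∑ b', P (a, b')) * (∑ a', P (a', b))))

section Channel

variable {X Y Z S : Type*}

/-- The marginal `p_{Y|X,S}(b|a,s)` of the compound channel `W (a, s) (b, c) = p(b,c|a,s)`. -/
def margY [Fintype Z] (W : X × S → Y × Z → ℝ) (s : S) (a : X) (b : Y) : ℝ := ∑ c, W (a, s) (b, c)

/-- The marginal `p_{Z|X,S}(c|a,s)` of the compound channel. -/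
def margZ [Fintype Y] (W : X × S → Y × Z → ℝ) (s : S) (a : X) (c : Z) : ℝ := ∑ b, W (a, s) (b, c)

/-- A code of blocklength `n` for `M` messages: a deterministic encoder and a decoder,
neither of which knows the channel state. -/
structure Code (X Y : Type*) (M n : ℕ) where
  enc : Fin M → Fin n → X
  dec : (Fin n → Y) → Fin M

/-- Number of messages of a `(2^{nR}, n)`-code, rounded up to an integer. -/
def numMessages (R : ℝ) (n : ℕ) : ℕ := ⌈(2 : ℝ) ^ ((n : ℝ) * R)⌉₊

/-- Joint law of the (uniform) message and the two output sequences, when `s` is the channel state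
throughout the block and the channel is memoryless. -/
def jointLaw (W : X × S → Y × Z → ℝ) (s : S) {M n : ℕ} (c : Code X Y M n)
    (m : Fin M) (y : Fin n → Y) (z : Fin n → Z) : ℝ :=
  (1 / (M : ℝ)) * ∏ i, W (c.enc m i, s) (y i, z i)

/-- Probability that the decoded message differs from the sent one when the state is `s`. -/
def errorProb [Fintype Y] [Fintype Z] (W : X × S → Y × Z → ℝ) (s : S) {M n : ℕ}
    (c : Code X Y M n) : ℝ :=
  ∑ m, ∑ y, ∑ z, if c.dec y ≠ m then jointLaw W s c m y z else 0

/-- The distribution of the observer's sequence induced by the code when the state is `s`. -/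
def inducedDist [Fintype Y] (W : X × S → Y × Z → ℝ) (s : S) {M n : ℕ}
    (c : Code X Y M n) (z : Fin n → Z) : ℝ :=
  ∑ m, ∑ y, jointLaw W s c m y z

/-- Expected variational distance between `Q` and the type of the observer's sequence
when the state is `s`. -/
def expectedDist [Fintype Y] [Fintype Z] [DecidableEq Z] (W : X × S → Y × Z → ℝ) (Q : Z → ℝ)
    (s : S) {M n : ℕ} (c : Code X Y M n) : ℝ :=
  ∑ z, inducedDist W s c z * varDist Q (typeOf z)

/-- The rate `R` is `(Δ_s)_s`-achievable with interference type `Q`. -/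
def Achievable [Fintype Y] [Fintype Z] [DecidableEq Z] (W : X × S → Y × Z → ℝ) (Q : Z → ℝ)
    (R : ℝ) (Δ : S → ℝ) : Prop :=
  ∀ ε : ℝ, 0 < ε → ∃ n₀ : ℕ, ∀ n : ℕ, n₀ < n → ∃ c : Code X Y (numMessages R n) n,
    (∀ s, errorProb W s c < ε) ∧ ∀ s, expectedDist W Q s c ≤ Δ s

/-- The communication-adaptive interference capacity region: the closure of the set of all
achievable tuples of a (nonnegative) rate and precisions. -/
def capacityRegion [Fintype Y] [Fintype Z] [DecidableEq Z] (W : X × S → Y × Z → ℝ) (Q : Z → ℝ) :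
    Set (ℝ × (S → ℝ)) :=
  closure {t | 0 ≤ t.1 ∧ Achievable W Q t.1 t.2}

/-- The input types that lie in the `Δ_s`-pre-image of `Q` under `p_{Z|X,S=s}` for every `s`. -/
def feasibleInputs [Fintype X] [DecidableEq X] [Fintype Y] [Fintype Z] [DecidableEq Z]
    (W : X × S → Y × Z → ℝ) (Q : Z → ℝ) (Δ : S → ℝ) : Set (X → ℝ) :=
  ⋂ s, deltaPreimage (Δ s) Q (margZ W s)

end Channel

end InterferenceCoordination

end

open InterferenceCoordination

namespace InterferenceCoordination

/-! ### Sums over product spaces -/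

section ProductSums

variable {ι A : Type*} [Fintype ι] [DecidableEq ι] [Fintype A]

/-! The expected type of the observer's sequence depends on a code only through the distribution `N`
of its letters, averaged over messages and positions: in state `s` it is the mixture of the rows of
`margZ W s` with weights `N`. Moreover `N` is itself a type, that of the concatenation of all
codewords, and it does not depend on `s`.

Converse: convexity of the variational distance puts this `N` into the feasible set with no loss in
`Δ` (`varDist_mixture_le`). A Fano inequality, with the output law of `N` as reference measure,
bounds the rate by the information of `N` in each state, up to vanishing terms (`log_messages_le`).
The same `N` serves all states, hence the minimum over `s`.

Achievability: for a feasible `N` the codewords are drawn i.i.d. from `N`, and the decoder accepts a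
codeword whose information density is large for some state. Chebyshev's inequality handles the sent
codeword; a change of measure and a union bound over codewords and the finitely many states handle
the others. Averaged over codebooks, the observer's sequence is exactly i.i.d., so its type
concentrates. The sum of all error probabilities and deviations over all states has small mean, so a
single codebook is good in every state (`exists_code_sum_le`, `exists_codes`).

The small losses in rate and precision disappear in the closure. -/

lemma sum_prod_pi (f : ι → A → ℝ) : ∑ y : ι → A, ∏ i, f i (y i) = ∏ i, ∑ a, f i a := by
  classical
  rw [Finset.prod_univ_sum, Fintype.piFinset_univ]

lemma sum_prod_pi_eq_one {f : ι → A → ℝ} (hf : ∀ i, ∑ a, f i a = 1) :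
    ∑ y : ι → A, ∏ i, f i (y i) = 1 := by
  rw [sum_prod_pi]; simp [hf]

lemma sum_prod_pi_mul_apply {f : ι → A → ℝ} (hf : ∀ i, ∑ a, f i a = 1) (k : ι) (g : A → ℝ) :
    ∑ y : ι → A, (∏ i, f i (y i)) * g (y k) = ∑ a, f k a * g a := by
  -- The test function is absorbed into the `k`-th factor, so that sum and product can be exchanged.
  have h1 : ∀ y : ι → A, (∏ i, f i (y i)) * g (y k)
      = ∏ i, f i (y i) * (if i = k then g (y i) else 1) := by
    intro y
    rw [Finset.prod_mul_distrib, Finset.prod_ite_eq' Finset.univ k (fun i => g (y i))]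
    simp
  simp_rw [h1]
  rw [sum_prod_pi (fun i a => f i a * (if i = k then g a else 1)),
    Finset.prod_eq_single k]
  · simp
  · intro i _ hik
    simp [hik, hf]
  · simp

lemma sum_prod_pi_mul_apply_mul_apply {f : ι → A → ℝ} (hf : ∀ i, ∑ a, f i a = 1) {k l : ι}
    (hkl : k ≠ l) (g h : A → ℝ) :
    ∑ y : ι → A, (∏ i, f i (y i)) * (g (y k) * h (y l))
      = (∑ a, f k a * g a) * ∑ a, f l a * h a := by
  have h1 : ∀ y : ι → A, (∏ i, f i (y i)) * (g (y k) * h (y l))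
      = ∏ i, f i (y i) * ((if i = k then g (y i) else 1) * (if i = l then h (y i) else 1)) := by
    intro y
    rw [Finset.prod_mul_distrib, Finset.prod_mul_distrib,
      Finset.prod_ite_eq' Finset.univ k (fun i => g (y i)),
      Finset.prod_ite_eq' Finset.univ l (fun i => h (y i))]
    simp
  simp_rw [h1]
  rw [sum_prod_pi (fun i a => f i a * ((if i = k then g a else 1) * (if i = l then h a else 1))),
    Finset.prod_eq_mul k l hkl]
  · simp [hkl, hkl.symm]
  · intro i _ hi
    simp [hi.1, hi.2, hf]
  · simp
  · simp

/-- The second moment of a sum of independent centred variables. -/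
lemma sum_prod_pi_mul_sum_sq {p : A → ℝ} (hp : ∑ a, p a = 1) {f : A → ℝ}
    (hf : ∑ a, p a * f a = 0) :
    ∑ y : ι → A, (∏ i, p (y i)) * (∑ i, f (y i)) ^ 2
      = Fintype.card ι * ∑ a, p a * f a ^ 2 := by
  have h1 : ∀ y : ι → A, (∏ i, p (y i)) * (∑ i, f (y i)) ^ 2
      = ∑ k, ∑ l, (∏ i, p (y i)) * (f (y k) * f (y l)) := by
    intro y
    rw [sq, Finset.sum_mul_sum, Finset.mul_sum]
    exact Finset.sum_congr rfl fun k _ => Finset.mul_sum _ _ _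
  simp_rw [h1]
  rw [Finset.sum_comm]
  have h2 : ∀ k : ι, ∑ y : ι → A, ∑ l, (∏ i, p (y i)) * (f (y k) * f (y l))
      = ∑ a, p a * f a ^ 2 := by
    intro k
    rw [Finset.sum_comm, Finset.sum_eq_single k]
    · rw [sum_prod_pi_mul_apply (f := fun _ => p) (fun _ => hp) k (fun a => f a * f a)]
      simp_rw [sq]
    · intro l _ hl
      rw [sum_prod_pi_mul_apply_mul_apply (f := fun _ => p) (fun _ => hp) hl.symm, hf, zero_mul]
    · simp
  simp [h2]

/-- Chebyshev's inequality for the lower tail of a sum of independent variables. -/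
lemma sum_prod_pi_lower_tail {p : A → ℝ} (hp0 : ∀ a, 0 ≤ p a) (hp : ∑ a, p a = 1) (f : A → ℝ)
    {γ μ : ℝ} (hμ : ∑ a, p a * f a = μ) (hγ : γ < μ) {n : ℕ} (hn : 0 < n) :
    ∑ y : Fin n → A, (if ∑ i, f (y i) ≤ γ * n then ∏ i, p (y i) else 0)
      ≤ (∑ a, p a * (f a - μ) ^ 2) / (μ - γ) ^ 2 / n := by
  have hn' : (0 : ℝ) < n := by exact_mod_cast hn
  have hd : 0 < μ - γ := sub_pos.2 hγ
  have hc : ∑ a, p a * (f a - μ) = 0 := by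
    simp_rw [mul_sub, Finset.sum_sub_distrib, ← Finset.sum_mul, hμ, hp]; ring
  have h2 := sum_prod_pi_mul_sum_sq (ι := Fin n) hp hc
  rw [Fintype.card_fin] at h2
  -- On the event, the centred sum is at most `-n (μ - γ)`, so its square dominates `(n (μ - γ)) ^
  -- 2`.
  have h3 : ∀ y : Fin n → A, (if ∑ i, f (y i) ≤ γ * n then ∏ i, p (y i) else 0)
      ≤ ((∏ i, p (y i)) * (∑ i, (f (y i) - μ)) ^ 2) / (n * (μ - γ)) ^ 2 := by
    intro y
    have hP : 0 ≤ ∏ i, p (y i) := Finset.prod_nonneg fun i _ => hp0 _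
    split_ifs with h
    · rw [le_div_iff₀ (by positivity)]
      refine mul_le_mul_of_nonneg_left ?_ hP
      rw [sq_le_sq, abs_of_nonneg (by positivity), Finset.sum_sub_distrib]
      simp only [Finset.sum_const, Finset.card_univ, Fintype.card_fin, nsmul_eq_mul]
      rw [abs_of_nonpos (by nlinarith)]
      nlinarith
    · positivity
  refine (Finset.sum_le_sum fun y _ => h3 y).trans (le_of_eq ?_)
  rw [← Finset.sum_div, h2]
  field_simp

end ProductSums

/-! ### Types -/

section Types

variable {A : Type*} [DecidableEq A]

lemma sum_typeOf_mul [Fintype A] {n : ℕ} (x : Fin n → A) (g : A → ℝ) :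
    ∑ a, typeOf x a * g a = (∑ i, g (x i)) / n := by
  have h : ∀ a, typeOf x a * g a = (∑ i, if x i = a then g a else 0) / n := by
    intro a
    rw [typeOf, ← Finset.sum_filter, Finset.sum_const, nsmul_eq_mul]; ring
  simp_rw [h, ← Finset.sum_div]
  rw [Finset.sum_comm]
  simp

lemma typeOf_eq_sum {n : ℕ} (x : Fin n → A) (a : A) :
    typeOf x a = (∑ i, if x i = a then (1 : ℝ) else 0) / n := by
  rw [typeOf]; simp

/-- With a common denominator `d` of the values, a sequence of length `d` that lists each `a`
exactly `P a * d` times has type `P`. -/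
lemma mem_types_iff [Fintype A] (P : A → ℝ) :
    P ∈ types A ↔ (∀ a, 0 ≤ P a) ∧ ∑ a, P a = 1 ∧ ∀ a, ∃ q : ℚ, P a = q := by
  constructor
  · rintro ⟨n, hn, x, rfl⟩
    refine ⟨fun a => by unfold typeOf; positivity, ?_, fun a => ?_⟩
    · have := sum_typeOf_mul x (fun _ => 1)
      have hn' : (n : ℝ) ≠ 0 := by positivity
      simpa [hn'] using this
    · exact ⟨((Finset.univ.filter fun i => x i = a).card : ℚ) / n, by simp [typeOf]⟩
  · rintro ⟨h0, h1, hq⟩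
    choose q hq using hq
    have hq0 : ∀ a, 0 ≤ q a := fun a => by have := h0 a; rw [hq] at this; exact_mod_cast this
    set d : ℕ := ∏ a, (q a).den with hd
    have hdpos : 0 < d := Finset.prod_pos fun a _ => (q a).pos
    have hk : ∀ a, ∃ k : ℕ, P a * d = k := by
      intro a
      refine ⟨(q a).num.toNat * ∏ b ∈ Finset.univ.erase a, (q b).den, ?_⟩
      have hnum : ((q a).num.toNat : ℤ) = (q a).num := Int.toNat_of_nonneg (Rat.num_nonneg.2 (hq0 a))
      have h2 : ((q a : ℚ) : ℝ) * (q a).den = ((q a).num.toNat : ℝ) := by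
        have : (((q a).num.toNat : ℤ) : ℝ) = ((q a).num : ℝ) := by rw [hnum]
        rw [Int.cast_natCast] at this
        rw [this]
        exact_mod_cast Rat.mul_den_eq_num (q a)
      rw [hd, ← Finset.mul_prod_erase _ _ (Finset.mem_univ a), hq a]
      push_cast
      rw [← mul_assoc, h2]
    choose k hk using hk
    have hsum : ∑ a, k a = d := by
      have : (∑ a, (k a : ℝ)) = d := by
        simp_rw [← hk, ← Finset.sum_mul, h1, one_mul]
      exact_mod_cast this
    have e : Fin d ≃ Σ a, Fin (k a) := Fintype.equivOfCardEq (by simp [hsum])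
    refine ⟨d, hdpos, fun i => (e i).1, ?_⟩
    funext a
    have hdr : (d : ℝ) ≠ 0 := by positivity
    rw [typeOf, eq_div_iff hdr, hk a]
    congr 1
    have : (Finset.univ.filter fun i => (e i).1 = a).card
        = (Finset.univ.filter fun w : Σ a, Fin (k a) => w.1 = a).card :=
      Finset.card_bij (fun i _ => e i) (by simp) (fun _ _ _ _ h => e.injective h)
        (fun w hw => ⟨e.symm w, by simpa using hw, by simp⟩)
    rw [this]
    have h3 : (Finset.univ.filter fun w : Σ a, Fin (k a) => w.1 = a)
        = Finset.univ.map ⟨fun j : Fin (k a) => (⟨a, j⟩ : Σ a, Fin (k a)),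
            fun i j h => by simpa using h⟩ := by
      ext ⟨b, j⟩
      simp only [Finset.mem_filter, Finset.mem_univ, true_and, Finset.mem_map]
      constructor
      · rintro rfl; exact ⟨j, rfl⟩
      · rintro ⟨j', h⟩; exact (congrArg Sigma.fst h).symm
    rw [h3]; simp

lemma typeOf_mem_types {n : ℕ} (hn : 1 ≤ n) (x : Fin n → A) : typeOf x ∈ types A :=
  ⟨n, hn, x, rfl⟩

lemma condTypes_nonneg {B : Type*} [DecidableEq B] {J : A → B → ℝ} (hJ : J ∈ condTypes A B)
    (a : A) (b : B) : 0 ≤ J a b := by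
  obtain ⟨n, -, x, y, -, h⟩ := hJ
  rw [h]; positivity

lemma condTypes_sum {B : Type*} [Fintype B] [DecidableEq B] {J : A → B → ℝ}
    (hJ : J ∈ condTypes A B) (a : A) : ∑ b, J a b = 1 := by
  obtain ⟨n, -, x, y, hx, h⟩ := hJ
  simp_rw [h, ← Finset.sum_div]
  have h0 : ((Finset.univ.filter fun i => x i = a).card : ℝ) ≠ 0 := by
    have := hx a; positivity
  rw [div_eq_one_iff_eq h0, ← Nat.cast_sum]
  congr 1
  rw [Finset.card_eq_sum_card_fiberwise (f := y) (t := Finset.univ) (by simp)]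
  simp [Finset.filter_filter]

lemma condTypes_rat {B : Type*} [DecidableEq B] {J : A → B → ℝ} (hJ : J ∈ condTypes A B)
    (a : A) (b : B) : ∃ q : ℚ, J a b = q := by
  obtain ⟨n, -, x, y, -, h⟩ := hJ
  exact ⟨((Finset.univ.filter fun i => x i = a ∧ y i = b).card : ℚ) /
        ((Finset.univ.filter fun i => x i = a).card : ℚ), by rw [h]; push_cast; rfl⟩

/-- The image of a type under a rational channel is a type. -/
lemma mixture_mem_types {B : Type*} [Fintype A] [Fintype B] [DecidableEq B] {P : A → ℝ} (hP : P ∈ types A)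
    {J : A → B → ℝ} (h0 : ∀ a b, 0 ≤ J a b) (h1 : ∀ a, ∑ b, J a b = 1)
    (hq : ∀ a b, ∃ q : ℚ, J a b = q) : (fun b => ∑ a, P a * J a b) ∈ types B := by
  rw [mem_types_iff] at hP ⊢
  obtain ⟨hP0, hP1, hPq⟩ := hP
  refine ⟨fun b => Finset.sum_nonneg fun a _ => mul_nonneg (hP0 a) (h0 a b), ?_, fun b => ?_⟩
  · rw [Finset.sum_comm]
    simp_rw [← Finset.mul_sum, h1, mul_one, hP1]
  · choose q hq using hq
    choose p hp using hPq
    exact ⟨∑ a, p a * q a b, by push_cast; simp_rw [hp, hq]⟩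

end Types

/-! ### Relative entropy and mutual information -/

section Information

/-- The pointwise form of Gibbs' inequality. -/
lemma sub_le_mul_log_div {p q : ℝ} (hp : 0 ≤ p) (hq : 0 ≤ q) (h : 0 < p → 0 < q) :
    p - q ≤ p * Real.log (p / q) := by
  rcases hp.eq_or_lt with rfl | hp
  · simpa using hq
  · have hq := h hp
    have h1 := Real.log_le_sub_one_of_pos (div_pos hq hp)
    have h2 : Real.log (p / q) = - Real.log (q / p) := by
      rw [← Real.log_inv, inv_div]
    rw [h2]
    have h3 : p * (q / p - 1) = q - p := by field_simp
    nlinarith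

lemma jointType_nonneg {A B : Type*} {P : A → ℝ} {J : A → B → ℝ} (hP : ∀ a, 0 ≤ P a)
    (hJ : ∀ a b, 0 ≤ J a b) (w : A × B) : 0 ≤ jointType P J w := mul_nonneg (hP _) (hJ _ _)

variable {A B : Type*} [Fintype A] [Fintype B]

lemma mutualInfo_nonneg {P : A × B → ℝ} (h0 : ∀ w, 0 ≤ P w) (h1 : ∑ a, ∑ b, P (a, b) = 1) :
    0 ≤ mutualInfo P := by
  have hl : (0 : ℝ) < Real.log 2 := Real.log_pos one_lt_two
  have key : 0 ≤ ∑ a, ∑ b, P (a, b) *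
      Real.log (P (a, b) / ((∑ b', P (a, b')) * (∑ a', P (a', b)))) := by
    have hs : ∑ a, ∑ b, (P (a, b) - (∑ b', P (a, b')) * (∑ a', P (a', b))) = 0 := by
      simp_rw [Finset.sum_sub_distrib, ← Finset.mul_sum]
      rw [← Finset.sum_mul, h1, Finset.sum_comm, h1]; ring
    rw [← hs]
    refine Finset.sum_le_sum fun a _ => Finset.sum_le_sum fun b _ => ?_
    have hA : P (a, b) ≤ ∑ b', P (a, b') :=
      Finset.single_le_sum (f := fun b' => P (a, b')) (fun _ _ => h0 _) (Finset.mem_univ b)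
    have hB : P (a, b) ≤ ∑ a', P (a', b) :=
      Finset.single_le_sum (f := fun a' => P (a', b)) (fun _ _ => h0 _) (Finset.mem_univ a)
    exact sub_le_mul_log_div (h0 _) (mul_nonneg ((h0 _).trans hA) ((h0 _).trans hB))
      fun h => mul_pos (h.trans_le hA) (h.trans_le hB)
  have : mutualInfo P = (∑ a, ∑ b, P (a, b) *
      Real.log (P (a, b) / ((∑ b', P (a, b')) * (∑ a', P (a', b))))) / Real.log 2 := by
    simp_rw [mutualInfo, Real.logb, Finset.sum_div, mul_div_assoc]
  rw [this]
  positivity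

/-- Each term is at most `1 / log 2`, because `log x ≤ x` and `P (a, b)` is below both marginals.
The bound is crude; only finiteness of the supremum is at stake. -/
lemma mutualInfo_le {P : A × B → ℝ} (h0 : ∀ w, 0 ≤ P w) :
    mutualInfo P ≤ Fintype.card A * (Fintype.card B * (1 / Real.log 2)) := by
  have hl : (0 : ℝ) < Real.log 2 := Real.log_pos one_lt_two
  have key : ∀ a b, P (a, b) *
      Real.logb 2 (P (a, b) / ((∑ b', P (a, b')) * (∑ a', P (a', b)))) ≤ 1 / Real.log 2 := by
    intro a b
    have hA : P (a, b) ≤ ∑ b', P (a, b') :=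
      Finset.single_le_sum (f := fun b' => P (a, b')) (fun _ _ => h0 _) (Finset.mem_univ b)
    have hB : P (a, b) ≤ ∑ a', P (a', b) :=
      Finset.single_le_sum (f := fun a' => P (a', b)) (fun _ _ => h0 _) (Finset.mem_univ a)
    have hAB := mul_nonneg ((h0 _).trans hA) ((h0 _).trans hB)
    rw [Real.logb, ← mul_div_assoc]
    refine div_le_div_of_nonneg_right ?_ hl.le
    calc _ ≤ P (a, b) * (P (a, b) / ((∑ b', P (a, b')) * (∑ a', P (a', b)))) :=
          mul_le_mul_of_nonneg_left (Real.log_le_self (div_nonneg (h0 _) hAB)) (h0 _)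
      _ = (P (a, b) * P (a, b)) / ((∑ b', P (a, b')) * (∑ a', P (a', b))) := by ring
      _ ≤ 1 := div_le_one_of_le₀ (mul_le_mul hA hB (h0 _) ((h0 _).trans hA)) hAB
  calc mutualInfo P ≤ ∑ _a : A, ∑ _b : B, 1 / Real.log 2 :=
        Finset.sum_le_sum fun a _ => Finset.sum_le_sum fun b _ => key a b
    _ = _ := by simp

/-- The input probability cancels inside the logarithm, and letters of probability zero contribute
nothing on either side. Both halves of the proof use information as a mean of this density. -/
lemma mutualInfo_jointType {P : A → ℝ} {J : A → B → ℝ} (h1 : ∀ a, ∑ b, J a b = 1) :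
    mutualInfo (jointType P J)
      = ∑ a, P a * ∑ b, J a b * Real.logb 2 (J a b / ∑ a', P a' * J a' b) := by
  unfold mutualInfo jointType
  refine Finset.sum_congr rfl fun a _ => ?_
  rw [Finset.mul_sum]
  refine Finset.sum_congr rfl fun b _ => ?_
  simp only [← Finset.mul_sum, h1, mul_one]
  rcases eq_or_ne (P a) 0 with h | h
  · simp [h]
  · rw [mul_div_mul_left _ _ h, mul_assoc]

lemma sum_jointType {P : A → ℝ} {J : A → B → ℝ} (hP : ∑ a, P a = 1) (hJ : ∀ a, ∑ b, J a b = 1) :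
    ∑ a, ∑ b, jointType P J (a, b) = 1 := by
  simp_rw [jointType, ← Finset.mul_sum, hJ, mul_one, hP]

end Information

/-! ### Laws induced by a code -/

section CodeLaws

variable {X Y Z S : Type*} {W : X × S → Y × Z → ℝ}

lemma margY_nonneg [Fintype Z] (h0 : ∀ a w, 0 ≤ W a w) (s : S) (a : X) (b : Y) : 0 ≤ margY W s a b :=
  Finset.sum_nonneg fun _ _ => h0 _ _

lemma margZ_nonneg [Fintype Y] (h0 : ∀ a w, 0 ≤ W a w) (s : S) (a : X) (c : Z) : 0 ≤ margZ W s a c :=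
  Finset.sum_nonneg fun _ _ => h0 _ _

lemma sum_margY [Fintype Y] [Fintype Z] (h1 : ∀ a, ∑ w, W a w = 1) (s : S) (a : X) : ∑ b, margY W s a b = 1 := by
  rw [← h1 (a, s), Fintype.sum_prod_type]; rfl

lemma sum_margZ [Fintype Y] [Fintype Z] (h1 : ∀ a, ∑ w, W a w = 1) (s : S) (a : X) : ∑ c, margZ W s a c = 1 := by
  rw [← h1 (a, s), Fintype.sum_prod_type_right]; rfl

/-- Summing out `z` in a memoryless law leaves a product of marginals, so the dependence between the
two outputs is irrelevant to decoding. -/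
lemma errorProb_eq [Fintype Y] [Fintype Z] (W : X × S → Y × Z → ℝ) (s : S) {M n : ℕ} (c : Code X Y M n) :
    errorProb W s c = ∑ m, ∑ y, if c.dec y ≠ m then
      1 / (M : ℝ) * ∏ i, margY W s (c.enc m i) (y i) else 0 := by
  refine Finset.sum_congr rfl fun m _ => Finset.sum_congr rfl fun y _ => ?_
  split_ifs
  · unfold jointLaw margY
    rw [← Finset.mul_sum, sum_prod_pi (fun i z => W (c.enc m i, s) (y i, z))]
  · simp

lemma inducedDist_eq [Fintype Y] (W : X × S → Y × Z → ℝ) (s : S) {M n : ℕ} (c : Code X Y M n)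
    (z : Fin n → Z) :
    inducedDist W s c z = ∑ m, 1 / (M : ℝ) * ∏ i, margZ W s (c.enc m i) (z i) := by
  refine Finset.sum_congr rfl fun m _ => ?_
  unfold jointLaw margZ
  rw [← Finset.mul_sum, sum_prod_pi (fun i y => W (c.enc m i, s) (y, z i))]

lemma inducedDist_nonneg [Fintype Y] (h0 : ∀ a w, 0 ≤ W a w) (s : S) {M n : ℕ} (c : Code X Y M n)
    (z : Fin n → Z) : 0 ≤ inducedDist W s c z := by
  rw [inducedDist_eq]
  exact Finset.sum_nonneg fun m _ => mul_nonneg (by positivity)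
    (Finset.prod_nonneg fun i _ => margZ_nonneg h0 _ _ _)

lemma sum_inducedDist [Fintype Y] [Fintype Z] (h1 : ∀ a, ∑ w, W a w = 1) (s : S) {M n : ℕ} (hM : 0 < M)
    (c : Code X Y M n) : ∑ z, inducedDist W s c z = 1 := by
  simp_rw [inducedDist_eq]
  rw [Finset.sum_comm]
  simp_rw [← Finset.mul_sum,
    sum_prod_pi_eq_one (f := fun i => margZ W s (c.enc _ i)) (fun i => sum_margZ h1 s _)]
  have : (M : ℝ) ≠ 0 := by positivity
  simp [this]

end CodeLaws

end InterferenceCoordination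

namespace InterferenceCoordination

/-! ### Converse -/

section Converse

variable {X Y Z S : Type*}

/-- The sequence of all letters of all codewords. -/
def allLetters {M n : ℕ} (c : Code X Y M n) (k : Fin (M * n)) : X :=
  c.enc (finProdFinEquiv.symm k).1 (finProdFinEquiv.symm k).2

lemma sum_typeOf_allLetters_mul [Fintype X] [DecidableEq X] {M n : ℕ} (c : Code X Y M n)
    (g : X → ℝ) :
    ∑ a, typeOf (allLetters c) a * g a = (∑ m, ∑ i, g (c.enc m i)) / (M * n) := by
  rw [sum_typeOf_mul, Nat.cast_mul]
  congr 1
  rw [← Fintype.sum_prod_type' (f := fun m i => g (c.enc m i))]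
  exact finProdFinEquiv.symm.sum_comp (fun w : Fin M × Fin n => g (c.enc w.1 w.2))

/-- A Fano-type inequality: if the average error probability is below `ε`, then
`(1 - ε) log M - 1` is at most the information between the average codeword letter and the
output. -/
lemma log_messages_le [Fintype X] [DecidableEq X] [Fintype Y] {J : X → Y → ℝ}
    (h0 : ∀ a b, 0 ≤ J a b) (h1 : ∀ a, ∑ b, J a b = 1) {M n : ℕ} (hM : 0 < M) (hn : 0 < n)
    (c : Code X Y M n) {ε : ℝ}
    (hε : (∑ m, ∑ y, if c.dec y ≠ m then 1 / (M : ℝ) * ∏ i, J (c.enc m i) (y i) else 0) ≤ ε) :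
    (1 - ε) * Real.logb 2 M - 1 ≤ n * mutualInfo (jointType (typeOf (allLetters c)) J) := by
  have hl : (0 : ℝ) < Real.log 2 := Real.log_pos one_lt_two
  have hM' : (0 : ℝ) < M := by exact_mod_cast hM
  have hn' : (0 : ℝ) < n := by exact_mod_cast hn
  have hM1 : (1 : ℝ) ≤ M := by exact_mod_cast hM
  have hlM : 0 ≤ Real.log M := Real.log_nonneg hM1
  set N := typeOf (allLetters c) with hN
  have hNt : N ∈ types X := typeOf_mem_types (Nat.mul_pos hM hn) _
  obtain ⟨hN0, hN1, -⟩ := (mem_types_iff N).1 hNt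
  set q : Y → ℝ := fun b => ∑ a, N a * J a b with hq
  have hq0 : ∀ b, 0 ≤ q b := fun b => Finset.sum_nonneg fun a _ => mul_nonneg (hN0 a) (h0 a b)
  have hq1 : ∑ b, q b = 1 := by
    rw [hq, Finset.sum_comm]; simp_rw [← Finset.mul_sum, h1, mul_one, hN1]
  -- Every letter of every codeword has positive weight in `N`; hence the true law is absolutely
  -- continuous with respect to the product of `q`.
  have hqpos : ∀ m i b, 0 < J (c.enc m i) b → 0 < q b := by
    intro m i b hb
    have : q b = (∑ m, ∑ i, J (c.enc m i) b) / (M * n) :=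
      sum_typeOf_allLetters_mul c (fun a => J a b)
    rw [this]
    refine div_pos (hb.trans_le ?_) (by positivity)
    refine le_trans ?_ (Finset.single_le_sum (f := fun m => ∑ i, J (c.enc m i) b)
      (fun m _ => Finset.sum_nonneg fun i _ => h0 _ _) (Finset.mem_univ m))
    exact Finset.single_le_sum (f := fun i => J (c.enc m i) b)
      (fun i _ => h0 _ _) (Finset.mem_univ i)
  let p : Fin M → (Fin n → Y) → ℝ := fun m y => 1 / (M : ℝ) * ∏ i, J (c.enc m i) (y i)
  -- The comparison measure for Gibbs' inequality: half of it guesses the decoded message, half is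
  -- roughly uniform in `m`, and `y` has the product law of `q`. The factor `M` at the decoded
  -- message produces the `log M` term, and the `2` costs one bit.
  let r : Fin M → (Fin n → Y) → ℝ := fun m y =>
    1 / (M : ℝ) * (∏ i, q (y i)) * (if c.dec y = m then (M : ℝ) else 1) / 2
  have hp0 : ∀ m y, 0 ≤ p m y := fun m y =>
    mul_nonneg (by positivity) (Finset.prod_nonneg fun i _ => h0 _ _)
  have hqn0 : ∀ y : Fin n → Y, 0 ≤ ∏ i, q (y i) := fun y => Finset.prod_nonneg fun i _ => hq0 _
  have hp1 : ∑ m, ∑ y, p m y = 1 := by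
    simp only [p, ← Finset.mul_sum]
    simp_rw [sum_prod_pi_eq_one (f := fun i => J (c.enc _ i)) (fun i => h1 _)]
    simp [hM'.ne']
  have hr1 : ∑ m, ∑ y, r m y ≤ 1 := by
    rw [Finset.sum_comm]
    have : ∀ y, ∑ m, r m y ≤ ∏ i, q (y i) := by
      intro y
      have hm : ∀ m, r m y ≤ 1 / (M : ℝ) * (∏ i, q (y i)) / 2
          + (if c.dec y = m then (∏ i, q (y i)) / 2 else 0) := by
        intro m
        have := hqn0 y
        simp only [r]
        split_ifs
        · have h2 : 1 / (M : ℝ) * (∏ i, q (y i)) * M / 2 = (∏ i, q (y i)) / 2 := by field_simp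
          rw [h2]
          have : 0 ≤ 1 / (M : ℝ) * (∏ i, q (y i)) / 2 := by positivity
          linarith
        · simp
      refine (Finset.sum_le_sum fun m _ => hm m).trans (le_of_eq ?_)
      rw [Finset.sum_add_distrib]
      simp only [Finset.sum_const, Finset.card_univ, Fintype.card_fin, nsmul_eq_mul,
        Finset.sum_ite_eq, Finset.mem_univ, if_true]
      field_simp
      ring
    refine (Finset.sum_le_sum fun y _ => this y).trans (le_of_eq ?_)
    exact sum_prod_pi_eq_one (f := fun _ : Fin n => q) (fun _ => hq1)
  have hterm : ∀ m y, p m y - r m y ≤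
      p m y * (∑ i, Real.log (J (c.enc m i) (y i) / q (y i))) - p m y * Real.log M
        + (if c.dec y ≠ m then p m y else 0) * Real.log M + p m y * Real.log 2 := by
    intro m y
    rcases (hp0 m y).eq_or_lt with h | hpos
    · have : 0 ≤ r m y := by
        simp only [r]
        have := hqn0 y
        split_ifs <;> positivity
      rw [← h]; simpa using this
    · have hJ : ∀ i, 0 < J (c.enc m i) (y i) := by
        intro i
        refine (h0 _ _).lt_of_ne fun hi => ?_
        have : p m y = 0 := by
          simp only [p]
          rw [Finset.prod_eq_zero (Finset.mem_univ i) hi.symm, mul_zero]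
        exact hpos.ne' this
      have hqi : ∀ i, 0 < q (y i) := fun i => hqpos m i _ (hJ i)
      have hqn : 0 < ∏ i, q (y i) := Finset.prod_pos fun i _ => hqi i
      have hrpos : 0 < r m y := by
        simp only [r]
        split_ifs <;> positivity
      refine (sub_le_mul_log_div hpos.le hrpos.le fun _ => hrpos).trans (le_of_eq ?_)
      have hlog : Real.log (p m y / r m y) = (∑ i, Real.log (J (c.enc m i) (y i) / q (y i)))
          - (if c.dec y = m then Real.log M else 0) + Real.log 2 := by
        have hJn : 0 < ∏ i, J (c.enc m i) (y i) := Finset.prod_pos fun i _ => hJ i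
        rw [← Real.log_prod (fun i _ => (div_pos (hJ i) (hqi i)).ne'), Finset.prod_div_distrib]
        have hpr : p m y / r m y = (∏ i, J (c.enc m i) (y i)) / (∏ i, q (y i)) /
            (if c.dec y = m then (M : ℝ) else 1) * 2 := by
          simp only [p, r]
          split_ifs <;> field_simp
        rw [hpr, Real.log_mul (by split_ifs <;> positivity) (by norm_num),
          Real.log_div (by positivity) (by split_ifs <;> positivity)]
        congr 2
        split_ifs <;> simp
      rw [hlog]
      by_cases hd : c.dec y = m
      · simp [hd]; ring
      · simp [hd]; ring
  -- Each codeword position has weight `1 / (M n)` in `N`, so the single-letter form is an exact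
  -- identity and needs no concavity of information.
  have hinfo : ∑ m, ∑ y, p m y * (∑ i, Real.log (J (c.enc m i) (y i) / q (y i)))
      = n * (mutualInfo (jointType N J) * Real.log 2) := by
    have hI : mutualInfo (jointType N J) * Real.log 2
        = ∑ a, N a * ∑ b, J a b * Real.log (J a b / q b) := by
      rw [mutualInfo_jointType h1, Finset.sum_mul]
      refine Finset.sum_congr rfl fun a _ => ?_
      rw [mul_assoc, Finset.sum_mul]
      congr 1
      refine Finset.sum_congr rfl fun b _ => ?_
      rw [Real.logb, mul_assoc, div_mul_cancel₀ _ hl.ne']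
    rw [hI, hN, sum_typeOf_allLetters_mul c (fun a => ∑ b, J a b * Real.log (J a b / q b))]
    have : ∀ m, ∑ y, p m y * (∑ i, Real.log (J (c.enc m i) (y i) / q (y i)))
        = 1 / (M : ℝ) * ∑ i, ∑ b, J (c.enc m i) b * Real.log (J (c.enc m i) b / q b) := by
      intro m
      simp only [p, mul_assoc, ← Finset.mul_sum]
      congr 1
      simp_rw [Finset.mul_sum]
      rw [Finset.sum_comm]
      exact Finset.sum_congr rfl fun i _ =>
        sum_prod_pi_mul_apply (f := fun i => J (c.enc m i)) (fun i => h1 _) i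
          (fun b => Real.log (J (c.enc m i) b / q b))
    simp_rw [this, ← Finset.mul_sum]
    field_simp
  have hsum := Finset.sum_le_sum fun m (_ : m ∈ Finset.univ) =>
    Finset.sum_le_sum fun y (_ : y ∈ Finset.univ) => hterm m y
  simp only [Finset.sum_add_distrib, Finset.sum_sub_distrib, ← Finset.sum_mul, hinfo, hp1] at hsum
  have hE : (∑ m, ∑ y, if c.dec y ≠ m then p m y else 0) * Real.log M ≤ ε * Real.log M :=
    mul_le_mul_of_nonneg_right hε hlM
  have hfin : (1 - ε) * Real.log M - Real.log 2
      ≤ n * (mutualInfo (jointType N J) * Real.log 2) := by linarith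
  have : (1 - ε) * Real.logb 2 M - 1 = ((1 - ε) * Real.log M - Real.log 2) / Real.log 2 := by
    rw [Real.logb]; field_simp
  rw [this, div_le_iff₀ hl, mul_assoc]
  exact hfin

/-- Jensen's inequality: the mixture is the mean of the observed type under the induced law, and `|Q
b - ·|` is convex. -/
lemma varDist_mixture_le [Fintype X] [DecidableEq X] [Fintype Y] [Fintype Z] [DecidableEq Z]
    {W : X × S → Y × Z → ℝ} (h0 : ∀ a w, 0 ≤ W a w) (h1 : ∀ a, ∑ w, W a w = 1) (Q : Z → ℝ)
    (s : S) {M n : ℕ} (hM : 0 < M) (c : Code X Y M n) :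
    varDist Q (fun b => ∑ a, typeOf (allLetters c) a * margZ W s a b) ≤ expectedDist W Q s c := by
  have hmean : ∀ b, ∑ a, typeOf (allLetters c) a * margZ W s a b
      = ∑ z, inducedDist W s c z * typeOf z b := by
    intro b
    rw [sum_typeOf_allLetters_mul c (fun a => margZ W s a b)]
    simp_rw [inducedDist_eq, Finset.sum_mul]
    rw [Finset.sum_comm (s := Finset.univ (α := Fin n → Z))]
    have : ∀ m, ∑ z : Fin n → Z, 1 / (M : ℝ) * (∏ i, margZ W s (c.enc m i) (z i)) * typeOf z b
        = (∑ i, margZ W s (c.enc m i) b) / (M * n) := by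
      intro m
      simp_rw [typeOf_eq_sum, mul_assoc, ← Finset.mul_sum, mul_div_assoc', ← Finset.sum_div,
        Finset.mul_sum]
      rw [Finset.sum_comm]
      have h2 : ∀ i, ∑ z : Fin n → Z, (∏ i, margZ W s (c.enc m i) (z i)) *
          (if z i = b then (1 : ℝ) else 0) = margZ W s (c.enc m i) b := by
        intro i
        rw [sum_prod_pi_mul_apply (f := fun i => margZ W s (c.enc m i))
          (fun i => sum_margZ h1 s _) i (fun z => if z = b then (1 : ℝ) else 0)]
        simp
      simp_rw [h2]
      rw [one_div, div_mul_eq_div_div]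
      ring
    simp_rw [this, ← Finset.sum_div]
  unfold expectedDist varDist
  simp_rw [hmean, Finset.mul_sum]
  rw [Finset.sum_comm]
  refine Finset.sum_le_sum fun b _ => ?_
  have hQ : Q b = ∑ z, inducedDist W s c z * Q b := by
    rw [← Finset.sum_mul, sum_inducedDist h1 s hM, one_mul]
  calc |Q b - ∑ z, inducedDist W s c z * typeOf z b|
      = |∑ z, inducedDist W s c z * (Q b - typeOf z b)| := by
        simp_rw [mul_sub, Finset.sum_sub_distrib, ← hQ]
    _ ≤ ∑ z, |inducedDist W s c z * (Q b - typeOf z b)| := Finset.abs_sum_le_sum_abs _ _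
    _ = _ := Finset.sum_congr rfl fun z _ => by
        rw [abs_mul, abs_of_nonneg (inducedDist_nonneg h0 s c z)]

end Converse

end InterferenceCoordination

namespace InterferenceCoordination

/-! ### Random coding -/

section RandomCoding

lemma exists_le_of_average_le {E : Type*} [Fintype E] {w F : E → ℝ} {B : ℝ} (hw : ∀ e, 0 ≤ w e)
    (h1 : ∑ e, w e = 1) (h : ∑ e, w e * F e ≤ B) : ∃ e, F e ≤ B := by
  by_contra! hc
  obtain ⟨e, -, he⟩ : ∃ e ∈ Finset.univ, 0 < w e := by
    by_contra! h2
    have := Finset.sum_nonpos h2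
    linarith
  have : ∑ e, w e * B < ∑ e, w e * F e :=
    Finset.sum_lt_sum (fun e _ => mul_le_mul_of_nonneg_left (hc e).le (hw e))
      ⟨e, Finset.mem_univ e, mul_lt_mul_of_pos_left (hc e) he⟩
  rw [← Finset.sum_mul, h1, one_mul] at this
  linarith

lemma varDist_triangle {A : Type*} [Fintype A] (P Q R : A → ℝ) :
    varDist P R ≤ varDist P Q + varDist Q R := by
  unfold varDist
  rw [← Finset.sum_add_distrib]
  exact Finset.sum_le_sum fun a _ => abs_sub_le _ _ _

/-- The mean deviation of the empirical distribution of an i.i.d. sequence. -/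
lemma sum_prod_pi_mul_varDist_typeOf_le {A : Type*} [Fintype A] [DecidableEq A] {p : A → ℝ}
    (hp0 : ∀ a, 0 ≤ p a) (hp : ∑ a, p a = 1) {n : ℕ} (hn : 0 < n) {t : ℝ} (ht : 0 < t) :
    ∑ z : Fin n → A, (∏ i, p (z i)) * varDist p (typeOf z)
      ≤ Fintype.card A * (t + 1 / t / n) := by
  have hn' : (0 : ℝ) < n := by exact_mod_cast hn
  have hP : ∀ z : Fin n → A, 0 ≤ ∏ i, p (z i) := fun z => Finset.prod_nonneg fun i _ => hp0 _
  simp_rw [varDist, Finset.mul_sum]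
  rw [Finset.sum_comm]
  have key : ∀ a, ∑ z : Fin n → A, (∏ i, p (z i)) * |p a - typeOf z a| ≤ t + 1 / t / n := by
    intro a
    set f : A → ℝ := fun b => (if b = a then (1 : ℝ) else 0) - p a with hf
    have hc : ∑ b, p b * f b = 0 := by
      simp [hf, mul_sub, ← Finset.sum_mul, hp]
    have hv : ∑ b, p b * f b ^ 2 ≤ 1 := by
      rw [← hp]
      refine Finset.sum_le_sum fun b _ => mul_le_of_le_one_right (hp0 b) ?_
      have hpa : p a ≤ 1 := hp ▸ Finset.single_le_sum (fun b _ => hp0 b) (Finset.mem_univ a)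
      have := hp0 a
      simp only [hf]
      split_ifs <;> nlinarith
    have h2 := sum_prod_pi_mul_sum_sq (ι := Fin n) hp hc
    rw [Fintype.card_fin] at h2
    -- The inequality `u ≤ t + u ^ 2 / t` reduces the mean deviation to the variance, with `t` left
    -- free.
    have hdev : ∀ z : Fin n → A, |p a - typeOf z a| ≤ t + (∑ i, f (z i)) ^ 2 / (t * n ^ 2) := by
      intro z
      have h3 : ∑ i, f (z i) = n * (typeOf z a - p a) := by
        rw [typeOf_eq_sum]
        simp only [hf, Finset.sum_sub_distrib, Finset.sum_const, Finset.card_univ,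
          Fintype.card_fin, nsmul_eq_mul]
        field_simp
      have h4 : (∑ i, f (z i)) ^ 2 / (t * n ^ 2) = |p a - typeOf z a| ^ 2 / t := by
        rw [h3, sq_abs]; field_simp; ring
      rw [h4]
      set u := |p a - typeOf z a|
      have h5 : t + u ^ 2 / t - u = ((t - u / 2) ^ 2 + 3 / 4 * u ^ 2) / t := by field_simp; ring
      have : 0 ≤ t + u ^ 2 / t - u := by rw [h5]; positivity
      linarith
    calc _ ≤ ∑ z : Fin n → A, (∏ i, p (z i)) * (t + (∑ i, f (z i)) ^ 2 / (t * n ^ 2)) :=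
          Finset.sum_le_sum fun z _ => mul_le_mul_of_nonneg_left (hdev z) (hP z)
      _ = t + (n * ∑ b, p b * f b ^ 2) / (t * n ^ 2) := by
          simp_rw [mul_add, Finset.sum_add_distrib, ← Finset.sum_mul, mul_div_assoc',
            ← Finset.sum_div, h2, sum_prod_pi_eq_one (f := fun _ : Fin n => p) (fun _ => hp),
            one_mul]
      _ = t + (∑ b, p b * f b ^ 2) / t / n := by field_simp
      _ ≤ _ := by gcongr
  refine (Finset.sum_le_sum fun a _ => key a).trans (le_of_eq ?_)
  rw [Finset.sum_const, Finset.card_univ, nsmul_eq_mul]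

variable {X Y Z S : Type*} [Fintype X]

/-- The output distribution of the channel `J` with input distribution `P`. -/
def mixture {B : Type*} (P : X → ℝ) (J : X → B → ℝ) (b : B) : ℝ := ∑ a, P a * J a b

/-- The information density of the pair `(x, y)` exceeds `n γ`. -/
def DensityExceeds {B : Type*} (P : X → ℝ) (J : X → B → ℝ) {n : ℕ} (γ : ℝ) (x : Fin n → X)
    (y : Fin n → B) : Prop :=
  (2 : ℝ) ^ (γ * n) * ∏ i, mixture P J (y i) < ∏ i, J (x i) (y i)

lemma mixture_nonneg {B : Type*} {P : X → ℝ} {J : X → B → ℝ} (hP : ∀ a, 0 ≤ P a)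
    (hJ : ∀ a b, 0 ≤ J a b) (b : B) : 0 ≤ mixture P J b :=
  Finset.sum_nonneg fun a _ => mul_nonneg (hP a) (hJ a b)

lemma sum_mixture {B : Type*} [Fintype B] {P : X → ℝ} {J : X → B → ℝ} (hP : ∑ a, P a = 1)
    (hJ : ∀ a, ∑ b, J a b = 1) : ∑ b, mixture P J b = 1 := by
  unfold mixture
  rw [Finset.sum_comm]; simp_rw [← Finset.mul_sum, hJ, mul_one, hP]

lemma sum_prod_mul_prod {B : Type*} (P : X → ℝ) (J : X → B → ℝ) {n : ℕ} (y : Fin n → B) :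
    ∑ x : Fin n → X, (∏ i, P (x i)) * ∏ i, J (x i) (y i) = ∏ i, mixture P J (y i) := by
  simp_rw [← Finset.prod_mul_distrib]
  exact sum_prod_pi (fun i a => P a * J a (y i))

open Classical in
/-- An independent codeword is unlikely to have large information density with a given output. -/
lemma sum_densityExceeds_le {B : Type*} {P : X → ℝ} {J : X → B → ℝ}
    (hP : ∀ a, 0 ≤ P a) (hJ : ∀ a b, 0 ≤ J a b) {n : ℕ} (γ : ℝ) (y : Fin n → B) :
    ∑ x : Fin n → X, (∏ i, P (x i)) * (if DensityExceeds P J γ x y then 1 else 0)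
      ≤ (2 : ℝ) ^ (-(γ * n)) := by
  set q := ∏ i, mixture P J (y i) with hq
  have hq0 : 0 ≤ q := Finset.prod_nonneg fun i _ => mixture_nonneg hP hJ _
  have hP' : ∀ x : Fin n → X, 0 ≤ ∏ i, P (x i) := fun x => Finset.prod_nonneg fun i _ => hP _
  have hJ' : ∀ x : Fin n → X, 0 ≤ ∏ i, J (x i) (y i) :=
    fun x => Finset.prod_nonneg fun i _ => hJ _ _
  have hsum := sum_prod_mul_prod P J y
  rw [← hq] at hsum
  have h2 : (0 : ℝ) < 2 ^ (γ * n) := Real.rpow_pos_of_pos two_pos _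
  -- If `y` has probability zero under the mixture, a word exceeding the threshold must itself have
  -- probability zero.
  rcases hq0.eq_or_lt with h | hpos
  · refine le_trans (Finset.sum_nonpos fun x _ => ?_) (Real.rpow_pos_of_pos two_pos _).le
    split_ifs with hd
    · rw [← h] at hsum
      have h0 := (Finset.sum_eq_zero_iff_of_nonneg
        (fun x _ => mul_nonneg (hP' x) (hJ' x))).1 hsum x (Finset.mem_univ x)
      unfold DensityExceeds at hd
      rw [← hq, ← h, mul_zero] at hd
      rcases mul_eq_zero.1 h0 with h0 | h0
      · simp [h0]
      · exact absurd h0 hd.ne'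
    · simp
  -- Change of measure: the indicator is at most the likelihood ratio divided by `2 ^ (γ n)`, and
  -- the ratio has mean one.
  · have hterm : ∀ x : Fin n → X, (∏ i, P (x i)) * (if DensityExceeds P J γ x y then 1 else 0)
        ≤ (∏ i, P (x i)) * (∏ i, J (x i) (y i)) / (2 ^ (γ * n) * q) := by
      intro x
      rw [mul_div_assoc]
      refine mul_le_mul_of_nonneg_left ?_ (hP' x)
      split_ifs with hd
      · rw [le_div_iff₀ (by positivity), one_mul]
        exact hd.le
      · exact div_nonneg (hJ' x) (by positivity)
    refine (Finset.sum_le_sum fun x _ => hterm x).trans (le_of_eq ?_)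
    rw [← Finset.sum_div, hsum, Real.rpow_neg two_pos.le]
    field_simp

open Classical in
/-- The transmitted codeword has large information density with the output, up to a
probability of order `1 / n`. -/
lemma exists_sum_not_densityExceeds_le {B : Type*} [Fintype B] {P : X → ℝ} {J : X → B → ℝ}
    (hP : ∀ a, 0 ≤ P a) (hP1 : ∑ a, P a = 1) (hJ : ∀ a b, 0 ≤ J a b)
    (hJ1 : ∀ a, ∑ b, J a b = 1) {γ : ℝ} (hγ : γ < mutualInfo (jointType P J)) :
    ∃ C : ℝ, ∀ n : ℕ, 0 < n → ∑ x : Fin n → X, ∑ y : Fin n → B,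
      (∏ i, P (x i)) * ((∏ i, J (x i) (y i)) * (if DensityExceeds P J γ x y then 0 else 1))
        ≤ C / n := by
  set f : X × B → ℝ := fun w => Real.logb 2 (J w.1 w.2 / mixture P J w.2) with hf
  set p : X × B → ℝ := jointType P J with hp
  have hp0 : ∀ w, 0 ≤ p w := jointType_nonneg hP hJ
  have hp1 : ∑ w, p w = 1 := by rw [Fintype.sum_prod_type]; exact sum_jointType hP1 hJ1
  have hμ : ∑ w, p w * f w = mutualInfo (jointType P J) := by
    rw [mutualInfo_jointType hJ1, Fintype.sum_prod_type]
    refine Finset.sum_congr rfl fun a _ => ?_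
    rw [Finset.mul_sum]
    exact Finset.sum_congr rfl fun b _ => mul_assoc _ _ _
  refine ⟨_, fun n hn => le_trans ?_ (sum_prod_pi_lower_tail hp0 hp1 f hμ hγ hn)⟩
  -- Read as a sequence of pairs, `(x, y)` is i.i.d. with law `p`, so the density is a sum of i.i.d.
  -- terms with mean the mutual information.
  rw [← (Equiv.arrowProdEquivProdArrow (Fin n) (fun _ => X) (fun _ => B)).symm.sum_comp,
    Fintype.sum_prod_type]
  refine Finset.sum_le_sum fun x _ => Finset.sum_le_sum fun y _ => ?_
  have hpe : ∏ i, p (x i, y i) = (∏ i, P (x i)) * ∏ i, J (x i) (y i) := by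
    rw [← Finset.prod_mul_distrib]; rfl
  have hnn : 0 ≤ ∏ i, p (x i, y i) := Finset.prod_nonneg fun i _ => hp0 _
  change _ ≤ if ∑ i, f (x i, y i) ≤ γ * n then ∏ i, p (x i, y i) else 0
  rw [← mul_assoc, ← hpe]
  by_cases hd : DensityExceeds P J γ x y
  · rw [if_pos hd, mul_zero]; split_ifs <;> simp [hnn]
  · rw [if_neg hd, mul_one]
    rcases hnn.eq_or_lt with h | hpos
    · rw [← h]; simp
    · have hpi : ∀ i, 0 < p (x i, y i) := by
        intro i
        refine (hp0 _).lt_of_ne fun hi => hpos.ne' ?_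
        exact Finset.prod_eq_zero (Finset.mem_univ i) hi.symm
      have hJi : ∀ i, 0 < J (x i) (y i) := fun i =>
        (hJ _ _).lt_of_ne fun h => (hpi i).ne' (by simp [hp, jointType, ← h])
      have hqi : ∀ i, 0 < mixture P J (y i) := fun i => (hpi i).trans_le
        (Finset.single_le_sum (f := fun a => P a * J a (y i))
          (fun a _ => mul_nonneg (hP a) (hJ a _)) (Finset.mem_univ (x i)))
      rw [if_pos]
      have hqn : 0 < ∏ i, mixture P J (y i) := Finset.prod_pos fun i _ => hqi i
      have hJn : 0 < ∏ i, J (x i) (y i) := Finset.prod_pos fun i _ => hJi i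
      have hs : ∑ i, f (x i, y i)
          = Real.logb 2 ((∏ i, J (x i) (y i)) / ∏ i, mixture P J (y i)) := by
        rw [← Finset.prod_div_distrib, Real.logb_prod _ _ fun i _ => (div_pos (hJi i) (hqi i)).ne']
      rw [hs, Real.logb_le_iff_le_rpow one_lt_two (div_pos hJn hqn), div_le_iff₀ hqn]
      exact not_lt.1 hd

end RandomCoding

end InterferenceCoordination

namespace InterferenceCoordination

/-! ### Achievability: threshold decoding for the compound channel -/

section Achievability

lemma expectedDist_le_add {X Y Z S : Type*} [Fintype Y] [Fintype Z] [DecidableEq Z]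
    {W : X × S → Y × Z → ℝ} (h0 : ∀ a w, 0 ≤ W a w) (h1 : ∀ a, ∑ w, W a w = 1) (Q Q' : Z → ℝ)
    (s : S) {M n : ℕ} (hM : 0 < M) (c : Code X Y M n) :
    expectedDist W Q s c ≤ varDist Q Q' + expectedDist W Q' s c := by
  have : varDist Q Q' = ∑ z, inducedDist W s c z * varDist Q Q' := by
    rw [← Finset.sum_mul, sum_inducedDist h1 s hM, one_mul]
  rw [this]
  unfold expectedDist
  rw [← Finset.sum_add_distrib]
  refine Finset.sum_le_sum fun z _ => ?_
  rw [← mul_add]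
  exact mul_le_mul_of_nonneg_left (varDist_triangle _ _ _) (inducedDist_nonneg h0 s c z)

variable {X Y Z S : Type*} [Fintype X]

open Classical in
/-- The code with encoder `e` whose decoder picks a codeword that has, for some channel state, large
information density with the output. -/
noncomputable def thresholdCode [Fintype Z] (W : X × S → Y × Z → ℝ) (P : X → ℝ) (γ : ℝ) {M n : ℕ} (hM : 0 < M)
    (e : Fin M → Fin n → X) : Code X Y M n where
  enc := e
  dec y := if h : ∃ m, ∃ s, DensityExceeds P (margY W s) γ (e m) y then h.choose else ⟨0, hM⟩

-- An error requires either that the sent codeword misses the threshold of the true state `s`, or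
-- that it meets it and the decoder, having a candidate, picks a wrong `m'` that meets the threshold
-- of some `s'`. The rest is a union bound.
open Classical in
lemma errorProb_thresholdCode_le [Fintype Y] [Fintype Z] [Fintype S] {W : X × S → Y × Z → ℝ}
    (h0 : ∀ a w, 0 ≤ W a w) (P : X → ℝ) (γ : ℝ) {M n : ℕ} (hM : 0 < M) (e : Fin M → Fin n → X)
    (s : S) :
    errorProb W s (thresholdCode W P γ hM e) ≤ 1 / (M : ℝ) * ∑ m,
      ((∑ y, (∏ i, margY W s (e m i) (y i)) *
          (if DensityExceeds P (margY W s) γ (e m) y then 0 else 1))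
        + ∑ m' ∈ Finset.univ.erase m, ∑ s', ∑ y, (∏ i, margY W s (e m i) (y i)) *
          (if DensityExceeds P (margY W s') γ (e m') y then 1 else 0)) := by
  rw [errorProb_eq, Finset.mul_sum]
  refine Finset.sum_le_sum fun m _ => ?_
  have hswap : ∑ m' ∈ Finset.univ.erase m, ∑ s' : S, ∑ y : Fin n → Y,
      (∏ i, margY W s (e m i) (y i)) *
        (if DensityExceeds P (margY W s') γ (e m') y then (1 : ℝ) else 0)
      = ∑ y : Fin n → Y, ∑ m' ∈ Finset.univ.erase m, ∑ s' : S, (∏ i, margY W s (e m i) (y i)) *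
        (if DensityExceeds P (margY W s') γ (e m') y then (1 : ℝ) else 0) := by
    rw [Finset.sum_comm (s := Finset.univ (α := Fin n → Y))]
    exact Finset.sum_congr rfl fun m' _ => Finset.sum_comm
  rw [hswap, ← Finset.sum_add_distrib, Finset.mul_sum]
  refine Finset.sum_le_sum fun y _ => ?_
  simp_rw [← Finset.mul_sum]
  rw [← mul_add, ← mul_assoc]
  set w := 1 / (M : ℝ) * ∏ i, margY W s (e m i) (y i) with hw
  have hw0 : 0 ≤ w := mul_nonneg (by positivity)
    (Finset.prod_nonneg fun i _ => margY_nonneg h0 _ _ _)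
  have hnn : ∀ m', 0 ≤ ∑ s' : S, if DensityExceeds P (margY W s') γ (e m') y
      then (1 : ℝ) else 0 := fun m' => Finset.sum_nonneg fun s' _ => by split_ifs <;> simp
  have hnn' := Finset.sum_nonneg fun m' (_ : m' ∈ Finset.univ.erase m) => hnn m'
  split_ifs with hdec hacc
  · change _ ≤ w * _
    refine le_mul_of_one_le_right hw0 ?_
    have hex : ∃ m, ∃ s, DensityExceeds P (margY W s) γ (e m) y := ⟨m, s, hacc⟩
    have hd : (thresholdCode W P γ hM e).dec y = hex.choose := by
      simp only [thresholdCode]; rw [dif_pos hex]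
    rw [hd] at hdec
    obtain ⟨s', hs'⟩ := hex.choose_spec
    rw [zero_add]
    refine le_trans ?_ (Finset.single_le_sum (fun m' _ => hnn m')
      (Finset.mem_erase.2 ⟨hdec, Finset.mem_univ hex.choose⟩))
    refine le_trans ?_ (Finset.single_le_sum (fun s' _ => by split_ifs <;> simp)
      (Finset.mem_univ s'))
    rw [if_pos hs']
  · change _ ≤ w * _
    exact le_mul_of_one_le_right hw0 (by linarith)
  · positivity
  · positivity

open Classical in
/-- The random coding bound. -/
lemma exists_code_sum_le [Fintype Y] [Fintype Z] [DecidableEq Z] [Fintype S]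
    {W : X × S → Y × Z → ℝ} (h0 : ∀ a w, 0 ≤ W a w) (h1 : ∀ a, ∑ w, W a w = 1) {P : X → ℝ}
    (hP : ∀ a, 0 ≤ P a) (hP1 : ∑ a, P a = 1) (γ : ℝ) {M : ℕ} (n : ℕ) (hM : 0 < M) :
    ∃ c : Code X Y M n,
      ∑ s, (errorProb W s c + expectedDist W (mixture P (margZ W s)) s c) ≤
        ∑ s, ((∑ x : Fin n → X, ∑ y : Fin n → Y, (∏ i, P (x i)) *
            ((∏ i, margY W s (x i) (y i)) *
              (if DensityExceeds P (margY W s) γ x y then 0 else 1)))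
          + ((M : ℝ) - 1) * (Fintype.card S * (2 : ℝ) ^ (-(γ * n)))
          + ∑ z : Fin n → Z, (∏ i, mixture P (margZ W s) (z i)) *
              varDist (mixture P (margZ W s)) (typeOf z)) := by
  have hM' : (0 : ℝ) < M := by exact_mod_cast hM
  let π : (Fin n → X) → ℝ := fun x => ∏ i, P (x i)
  have hπ0 : ∀ x, 0 ≤ π x := fun x => Finset.prod_nonneg fun i _ => hP _
  have hπ1 : ∑ x, π x = 1 := sum_prod_pi_eq_one (f := fun _ : Fin n => P) (fun _ => hP1)
  let w : (Fin M → Fin n → X) → ℝ := fun e => ∏ m, π (e m)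
  have hw0 : ∀ e, 0 ≤ w e := fun e => Finset.prod_nonneg fun m _ => hπ0 _
  have hw1 : ∑ e, w e = 1 := sum_prod_pi_eq_one (f := fun _ : Fin M => π) (fun _ => hπ1)
  have hone : ∀ (m : Fin M) (G : (Fin n → X) → ℝ), ∑ e, w e * G (e m) = ∑ x, π x * G x :=
    fun m G => sum_prod_pi_mul_apply (f := fun _ : Fin M => π) (fun _ => hπ1) m G
  have htwo : ∀ (m m' : Fin M), m ≠ m' → ∀ G H : (Fin n → X) → ℝ,
      ∑ e, w e * (G (e m) * H (e m')) = (∑ x, π x * G x) * ∑ x, π x * H x :=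
    fun m m' h G H => sum_prod_pi_mul_apply_mul_apply (f := fun _ : Fin M => π)
      (fun _ => hπ1) h G H
  -- Averaging the sum over all states, rather than each state separately, yields one codebook for
  -- all of them.
  suffices h : ∑ e, w e * ∑ s, (errorProb W s (thresholdCode W P γ hM e)
      + expectedDist W (mixture P (margZ W s)) s (thresholdCode W P γ hM e)) ≤ _ by
    obtain ⟨e, he⟩ := exists_le_of_average_le hw0 hw1 h
    exact ⟨_, he⟩
  simp_rw [Finset.mul_sum (s := Finset.univ (α := S))]
  rw [Finset.sum_comm]
  refine Finset.sum_le_sum fun s _ => ?_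
  simp_rw [mul_add, Finset.sum_add_distrib]
  refine add_le_add ?_ (le_of_eq ?_)
  · refine (Finset.sum_le_sum fun e _ => mul_le_mul_of_nonneg_left
      (errorProb_thresholdCode_le h0 P γ hM e s) (hw0 e)).trans ?_
    have hm : ∀ m, ∑ e, w e * ((∑ y : Fin n → Y, (∏ i, margY W s (e m i) (y i)) *
          (if DensityExceeds P (margY W s) γ (e m) y then 0 else 1))
        + ∑ m' ∈ Finset.univ.erase m, ∑ s', ∑ y : Fin n → Y, (∏ i, margY W s (e m i) (y i)) *
          (if DensityExceeds P (margY W s') γ (e m') y then 1 else 0)) ≤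
        (∑ x : Fin n → X, ∑ y : Fin n → Y, (∏ i, P (x i)) *
            ((∏ i, margY W s (x i) (y i)) *
              (if DensityExceeds P (margY W s) γ x y then 0 else 1)))
          + ((M : ℝ) - 1) * (Fintype.card S * (2 : ℝ) ^ (-(γ * n))) := by
      intro m
      simp_rw [mul_add, Finset.sum_add_distrib]
      refine add_le_add (le_of_eq ?_) ?_
      · rw [hone m (fun x => ∑ y : Fin n → Y, (∏ i, margY W s (x i) (y i)) *
          (if DensityExceeds P (margY W s) γ x y then 0 else 1))]
        simp_rw [Finset.mul_sum]
        rfl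
      · have hpair : ∀ m' ∈ Finset.univ.erase m, ∀ s' : S, ∑ e, w e * ∑ y : Fin n → Y,
            (∏ i, margY W s (e m i) (y i)) *
              (if DensityExceeds P (margY W s') γ (e m') y then 1 else 0)
            ≤ (2 : ℝ) ^ (-(γ * n)) := by
          intro m' hm' s'
          simp_rw [Finset.mul_sum]
          rw [Finset.sum_comm]
          -- The wrong codeword is independent of the sent one, hence of the output. The bound on
          -- its density holds for each fixed `y`, so `s'` need not be the true state.
          have hy : ∀ y : Fin n → Y, ∑ e, w e * ((∏ i, margY W s (e m i) (y i)) *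
              (if DensityExceeds P (margY W s') γ (e m') y then 1 else 0))
              ≤ (∏ i, mixture P (margY W s) (y i)) * (2 : ℝ) ^ (-(γ * n)) := by
            intro y
            rw [htwo m m' (Finset.ne_of_mem_erase hm').symm
              (fun x => ∏ i, margY W s (x i) (y i))
              (fun x => if DensityExceeds P (margY W s') γ x y then 1 else 0)]
            rw [sum_prod_mul_prod P (margY W s) y]
            exact mul_le_mul_of_nonneg_left
              (sum_densityExceeds_le hP (margY_nonneg h0 s') γ y)
              (Finset.prod_nonneg fun i _ => mixture_nonneg hP (margY_nonneg h0 s) _)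
          refine (Finset.sum_le_sum fun y _ => hy y).trans (le_of_eq ?_)
          rw [← Finset.sum_mul, sum_prod_pi_eq_one (f := fun _ : Fin n => mixture P (margY W s))
            (fun _ => sum_mixture hP1 (sum_margY h1 s)), one_mul]
        simp_rw [Finset.mul_sum (s := Finset.univ.erase m),
          Finset.mul_sum (s := Finset.univ (α := S))]
        rw [Finset.sum_comm]
        have hm'' : ∀ m' ∈ Finset.univ.erase m, ∑ e, ∑ s' : S, w e * ∑ y : Fin n → Y,
            (∏ i, margY W s (e m i) (y i)) *
              (if DensityExceeds P (margY W s') γ (e m') y then 1 else 0)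
            ≤ Fintype.card S * (2 : ℝ) ^ (-(γ * n)) := by
          intro m' hm'
          rw [Finset.sum_comm]
          refine (Finset.sum_le_sum fun s' _ => hpair m' hm' s').trans (le_of_eq ?_)
          simp
        refine (Finset.sum_le_sum hm'').trans (le_of_eq ?_)
        rw [Finset.sum_const, Finset.card_erase_of_mem (Finset.mem_univ m), Finset.card_univ,
          Fintype.card_fin, nsmul_eq_mul, Nat.cast_sub hM, Nat.cast_one]
    simp_rw [mul_left_comm _ (1 / (M : ℝ)),
      ← Finset.mul_sum (s := Finset.univ (α := Fin M → Fin n → X))]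
    simp_rw [Finset.mul_sum (s := Finset.univ (α := Fin M))]
    rw [Finset.sum_comm]
    refine (mul_le_mul_of_nonneg_left (Finset.sum_le_sum fun m _ => hm m)
      (by positivity)).trans (le_of_eq ?_)
    rw [Finset.sum_const, Finset.card_univ, Fintype.card_fin, nsmul_eq_mul, ← mul_assoc,
      one_div, inv_mul_cancel₀ hM'.ne', one_mul]
  · unfold expectedDist
    simp_rw [Finset.mul_sum]
    rw [Finset.sum_comm]
    refine Finset.sum_congr rfl fun z _ => ?_
    simp_rw [← mul_assoc, ← Finset.sum_mul]
    congr 1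
    simp_rw [inducedDist_eq, ← Finset.mul_sum, mul_left_comm _ (1 / (M : ℝ)), ← Finset.mul_sum]
    simp_rw [Finset.mul_sum (s := Finset.univ (α := Fin M))]
    rw [Finset.sum_comm]
    have : ∀ m : Fin M, ∑ e, w e * ∏ i, margZ W s ((thresholdCode W P γ hM e).enc m i) (z i)
        = ∏ i, mixture P (margZ W s) (z i) := by
      intro m
      rw [← sum_prod_mul_prod P (margZ W s) z]
      exact hone m (fun x => ∏ i, margZ W s (x i) (z i))
    rw [Finset.sum_congr rfl fun m _ => this m, Finset.sum_const, Finset.card_univ, Fintype.card_fin, nsmul_eq_mul, ← mul_assoc,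
      one_div, inv_mul_cancel₀ hM'.ne', one_mul]

lemma numMessages_pos (R : ℝ) (n : ℕ) : 0 < numMessages R n :=
  Nat.ceil_pos.2 (Real.rpow_pos_of_pos two_pos _)

lemma numMessages_sub_one_le (R : ℝ) (n : ℕ) :
    (numMessages R n : ℝ) - 1 ≤ (2 : ℝ) ^ ((n : ℝ) * R) :=
  sub_le_iff_le_add.2 (Nat.ceil_lt_add_one (Real.rpow_pos_of_pos two_pos _).le).le

open Filter Topology in
/-- The compound channel coding theorem, together with convergence of the empirical
interference to its mean. -/
lemma exists_codes [Fintype Y] [Fintype Z] [DecidableEq Z] [Fintype S]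
    {W : X × S → Y × Z → ℝ} (h0 : ∀ a w, 0 ≤ W a w) (h1 : ∀ a, ∑ w, W a w = 1) {P : X → ℝ}
    (hP : ∀ a, 0 ≤ P a) (hP1 : ∑ a, P a = 1) {γ R : ℝ}
    (hγ : ∀ s, γ < mutualInfo (jointType P (margY W s))) (hR : R = 0 ∨ R < γ)
    {ε : ℝ} (hε : 0 < ε) :
    ∃ n₀ : ℕ, ∀ n : ℕ, n₀ < n → ∃ c : Code X Y (numMessages R n) n,
      ∀ s, errorProb W s c < ε ∧ expectedDist W (mixture P (margZ W s)) s c < ε := by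
  classical
  choose C hC using fun s => exists_sum_not_densityExceeds_le hP hP1 (margY_nonneg h0 s)
    (sum_margY h1 s) (hγ s)
  obtain ⟨r, hr0, hr1, hr⟩ : ∃ r : ℝ, 0 ≤ r ∧ r < 1 ∧ ∀ n : ℕ,
      ((numMessages R n : ℝ) - 1) * (2 : ℝ) ^ (-(γ * n)) ≤ r ^ n := by
    -- At rate zero there is a single message and no wrong codeword, so no condition on `γ` is
    -- needed.
    rcases hR with rfl | hR
    · refine ⟨0, le_rfl, one_pos, fun n => ?_⟩
      simp [numMessages]
    · refine ⟨2 ^ (R - γ), (Real.rpow_pos_of_pos two_pos _).le,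
        Real.rpow_lt_one_of_one_lt_of_neg one_lt_two (by linarith), fun n => ?_⟩
      refine (mul_le_mul_of_nonneg_right (numMessages_sub_one_le R n)
        (Real.rpow_pos_of_pos two_pos _).le).trans (le_of_eq ?_)
      rw [← Real.rpow_add two_pos, ← Real.rpow_natCast, ← Real.rpow_mul two_pos.le]
      congr 1; ring
  set k : ℝ := Fintype.card S * Fintype.card Z with hk
  have hk0 : 0 ≤ k := by positivity
  -- Chosen so that the limit `k * t` of the total bound stays below `ε`.
  set t : ℝ := ε / (k + 1) with ht
  have ht0 : 0 < t := by positivity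
  set B : ℕ → ℝ := fun n => ∑ s : S, (C s / n + Fintype.card S * r ^ n
    + Fintype.card Z * (t + 1 / t / n)) with hB
  have hlim : Tendsto B atTop (𝓝 (∑ _s : S, (0 + Fintype.card S * 0
      + Fintype.card Z * (t + 0)))) := by
    refine tendsto_finsetSum _ fun s _ => ?_
    exact ((tendsto_const_div_atTop_nhds_zero_nat _).add
      ((tendsto_pow_atTop_nhds_zero_of_lt_one hr0 hr1).const_mul _)).add
      ((tendsto_const_nhds.add (tendsto_const_div_atTop_nhds_zero_nat _)).const_mul _)
  have hlt : ∑ _s : S, (0 + Fintype.card S * 0 + Fintype.card Z * (t + 0)) < ε := by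
    simp only [mul_zero, add_zero, zero_add, Finset.sum_const, Finset.card_univ, nsmul_eq_mul]
    rw [← mul_assoc, ← hk, ht, mul_div_assoc', div_lt_iff₀ (by positivity)]
    nlinarith
  obtain ⟨n₀, hn₀⟩ := eventually_atTop.1 (hlim.eventually_lt_const hlt)
  refine ⟨n₀, fun n hn => ?_⟩
  have hnpos : 0 < n := by omega
  obtain ⟨c, hc⟩ := exists_code_sum_le h0 h1 hP hP1 γ n (numMessages_pos R n)
  refine ⟨c, fun s => ?_⟩
  have hbound : ∑ s, (errorProb W s c + expectedDist W (mixture P (margZ W s)) s c) < ε := by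
    refine lt_of_le_of_lt (hc.trans (Finset.sum_le_sum fun s _ => ?_)) (hn₀ n hn.le)
    refine add_le_add (add_le_add (hC s n hnpos) ?_) ?_
    · rw [mul_left_comm]
      exact mul_le_mul_of_nonneg_left (hr n) (by positivity)
    · exact sum_prod_pi_mul_varDist_typeOf_le
        (fun z => mixture_nonneg hP (margZ_nonneg h0 s) z)
        (sum_mixture hP1 (sum_margZ h1 s)) hnpos ht0
  have he0 : ∀ s, 0 ≤ errorProb W s c := by
    intro s
    rw [errorProb_eq]
    refine Finset.sum_nonneg fun m _ => Finset.sum_nonneg fun y _ => ?_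
    split_ifs
    · exact mul_nonneg (by positivity) (Finset.prod_nonneg fun i _ => margY_nonneg h0 _ _ _)
    · exact le_rfl
  have hd0 : ∀ s, 0 ≤ expectedDist W (mixture P (margZ W s)) s c := fun s =>
    Finset.sum_nonneg fun z _ => mul_nonneg (inducedDist_nonneg h0 s c z)
      (Finset.sum_nonneg fun _ _ => abs_nonneg _)
  have hs := Finset.single_le_sum (fun s _ => add_nonneg (he0 s) (hd0 s)) (Finset.mem_univ s)
  have := he0 s
  have := hd0 s
  constructor <;> linarith

/-- Rates below the compound mutual information of a feasible input type are achievable after an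
arbitrarily small relaxation of the precisions. -/
lemma achievable_of_lt [DecidableEq X] [Fintype Y] [Fintype Z] [DecidableEq Z] [Fintype S]
    [Nonempty S] {W : X × S → Y × Z → ℝ} (h0 : ∀ a w, 0 ≤ W a w) (h1 : ∀ a, ∑ w, W a w = 1)
    {Q : Z → ℝ} {Δ : S → ℝ} {N : X → ℝ} (hN : N ∈ feasibleInputs W Q Δ) {R : ℝ}
    (hR : R = 0 ∨ R < ⨅ s, mutualInfo (jointType N (margY W s))) {δ : ℝ} (hδ : 0 < δ) :
    Achievable W Q R (fun s => Δ s + δ) := by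
  have hNs : ∀ s, N ∈ deltaPreimage (Δ s) Q (margZ W s) := Set.mem_iInter.1 hN
  obtain ⟨hN0, hN1, -⟩ := (mem_types_iff N).1 (hNs (Classical.arbitrary S)).1
  obtain ⟨γ, hγ, hRγ⟩ : ∃ γ, (∀ s, γ < mutualInfo (jointType N (margY W s))) ∧
      (R = 0 ∨ R < γ) := by
    rcases hR with hR | hR
    -- Any negative threshold works here, even when the information vanishes in some state.
    · exact ⟨-1, fun s => neg_one_lt_zero.trans_le (mutualInfo_nonneg
        (jointType_nonneg hN0 (margY_nonneg h0 s)) (sum_jointType hN1 (sum_margY h1 s))), .inl hR⟩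
    · obtain ⟨γ, h2, h3⟩ := exists_between hR
      exact ⟨γ, fun s => h3.trans_le (ciInf_le (Set.finite_range _).bddBelow s), .inr h2⟩
  intro ε hε
  obtain ⟨n₀, h⟩ := exists_codes h0 h1 hN0 hN1 hγ hRγ (lt_min hε hδ)
  refine ⟨n₀, fun n hn => ?_⟩
  obtain ⟨c, hc⟩ := h n hn
  refine ⟨c, fun s => (hc s).1.trans_le (min_le_left _ _), fun s => ?_⟩
  exact (expectedDist_le_add h0 h1 Q (mixture N (margZ W s)) s (numMessages_pos R n) c).trans
    (add_le_add (hNs s).2.2 ((hc s).2.le.trans (min_le_right _ _)))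

end Achievability

/-! ### Bounds on the region: rate converse and finiteness of the supremum -/

section Region

variable {X Y Z S : Type*} [Fintype X] [DecidableEq X] [Fintype Y] [Fintype Z] [DecidableEq Z]
  [Nonempty S] {W : X × S → Y × Z → ℝ} {Q : Z → ℝ}

lemma compoundInfo_nonneg (h0 : ∀ a w, 0 ≤ W a w) (h1 : ∀ a, ∑ w, W a w = 1) {Δ : S → ℝ}
    {N : X → ℝ} (hN : N ∈ feasibleInputs W Q Δ) :
    0 ≤ ⨅ s, mutualInfo (jointType N (margY W s)) := by
  refine le_ciInf fun s => ?_
  obtain ⟨hN0, hN1, -⟩ := (mem_types_iff N).1 (Set.mem_iInter.1 hN s).1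
  exact mutualInfo_nonneg (jointType_nonneg hN0 (margY_nonneg h0 s))
    (sum_jointType hN1 (sum_margY h1 s))

variable [Fintype S]

/-- The input types of codes with small error probability bound the rate. -/
lemma exists_feasibleInputs_of_achievable
    (h0 : ∀ a w, 0 ≤ W a w) (h1 : ∀ a, ∑ w, W a w = 1) (hq : ∀ a w, ∃ q : ℚ, W a w = q)
    {R : ℝ} (hR : 0 ≤ R) {Δ : S → ℝ} (h : Achievable W Q R Δ) {δ : ℝ} (hδ : 0 < δ) :
    ∃ N ∈ feasibleInputs W Q Δ, R - δ < ⨅ s, mutualInfo (jointType N (margY W s)) := by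
  -- The loss `δ` is split in two: `ε * R < δ / 2` covers the error probability, and `n > 2 / δ`
  -- makes the extra bit cost less than `δ / 2` per symbol. The cap `1` keeps `1 - ε` nonnegative.
  set ε := min 1 (δ / (2 * (R + 1))) with hε
  have hε0 : 0 < ε := lt_min one_pos (by positivity)
  have hεR : ε * R < δ / 2 := by
    calc ε * R ≤ δ / (2 * (R + 1)) * R := mul_le_mul_of_nonneg_right (min_le_right _ _) hR
      _ < δ / 2 := by
        rw [div_mul_eq_mul_div, div_lt_div_iff₀ (by positivity) two_pos]; nlinarith
  obtain ⟨n₀, hn₀⟩ := h ε hε0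
  obtain ⟨n₁, hn₁⟩ := exists_nat_gt (2 / δ)
  set n := max (n₀ + 1) n₁ with hn
  have hnpos : 0 < n := lt_of_lt_of_le (Nat.succ_pos _) (le_max_left _ _)
  have hn' : (0 : ℝ) < n := by exact_mod_cast hnpos
  obtain ⟨c, hc1, hc2⟩ := hn₀ n (lt_of_lt_of_le (Nat.lt_succ_self _) (le_max_left _ _))
  have hM := numMessages_pos R n
  have hNt := typeOf_mem_types (Nat.mul_pos hM hnpos) (allLetters c)
  refine ⟨typeOf (allLetters c), Set.mem_iInter.2 fun s => ⟨hNt, ?_, ?_⟩, ?_⟩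
  · refine mixture_mem_types hNt (margZ_nonneg h0 s) (sum_margZ h1 s) fun a z => ?_
    choose q hq using hq
    exact ⟨∑ b, q (a, s) (b, z), by simp [margZ, hq]⟩
  · exact (varDist_mixture_le h0 h1 Q s hM c).trans (hc2 s)
  · obtain ⟨s, hs⟩ := exists_eq_ciInf_of_finite
      (f := fun s => mutualInfo (jointType (typeOf (allLetters c)) (margY W s)))
    rw [← hs]
    have hlog := log_messages_le (margY_nonneg h0 s) (sum_margY h1 s) hM hnpos c
      (ε := ε) (by rw [← errorProb_eq]; exact (hc1 s).le)
    have hnR : n * R ≤ Real.logb 2 (numMessages R n) := by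
      rw [Real.le_logb_iff_rpow_le one_lt_two (by exact_mod_cast hM)]
      exact Nat.le_ceil _
    have h2 : (1 - ε) * (n * R) ≤ (1 - ε) * Real.logb 2 (numMessages R n) :=
      mul_le_mul_of_nonneg_left hnR (sub_nonneg.2 (min_le_left _ _))
    have h3 : 2 < δ * n := by
      have : 2 / δ < n := hn₁.trans_le (by exact_mod_cast le_max_right _ _)
      rwa [div_lt_iff₀' hδ] at this
    have h4 : n * (R - δ) < n * mutualInfo (jointType (typeOf (allLetters c)) (margY W s)) := by
      nlinarith
    exact lt_of_mul_lt_mul_left h4 hn'.le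

/-- Needed because `sSup` of an unbounded set of reals is the default value `0`. -/
lemma bddAbove_compoundInfo (h0 : ∀ a w, 0 ≤ W a w) (Δ : S → ℝ) :
    BddAbove ((fun N : X → ℝ => ⨅ s, mutualInfo (jointType N (margY W s))) ''
      feasibleInputs W Q Δ) := by
  refine ⟨Fintype.card X * (Fintype.card Y * (1 / Real.log 2)), ?_⟩
  rintro _ ⟨N, hN, rfl⟩
  have s := Classical.arbitrary S
  obtain ⟨hN0, -, -⟩ := (mem_types_iff N).1 (Set.mem_iInter.1 hN s).1
  exact (ciInf_le (Set.finite_range _).bddBelow s).trans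
    (mutualInfo_le (jointType_nonneg hN0 (margY_nonneg h0 s)))

end Region

end InterferenceCoordination

open InterferenceCoordination

theorem theorem3 {X Y Z S : Type*}
    [Fintype X] [DecidableEq X] [Fintype Y] [DecidableEq Y] [Fintype Z] [DecidableEq Z]
    [Fintype S] [DecidableEq S] [Nonempty S]
    (W : X × S → Y × Z → ℝ) (hW : W ∈ condTypes (X × S) (Y × Z))
    (Q : Z → ℝ) (hQ : Q ∈ types Z) :
    capacityRegion W Q =
      closure {t : ℝ × (S → ℝ) | (feasibleInputs W Q t.2).Nonempty ∧ 0 ≤ t.1 ∧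
        t.1 ≤ sSup ((fun N : X → ℝ => ⨅ s, mutualInfo (jointType N (margY W s))) ''
          feasibleInputs W Q t.2)} := by
  have h0 : ∀ a w, 0 ≤ W a w := condTypes_nonneg hW
  have h1 : ∀ a, ∑ w, W a w = 1 := condTypes_sum hW
  have hq : ∀ a w, ∃ q : ℚ, W a w = q := condTypes_rat hW
  apply subset_antisymm
  · refine closure_minimal ?_ isClosed_closure
    rintro ⟨R, Δ⟩ ⟨hR, hA⟩
    rw [Metric.mem_closure_iff]
    intro δ hδ
    obtain ⟨N, hN, hlt⟩ := exists_feasibleInputs_of_achievable h0 h1 hq hR hA (half_pos hδ)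
    refine ⟨(max 0 (R - δ / 2), Δ), ⟨⟨N, hN⟩, le_max_left _ _, ?_⟩, ?_⟩
    · refine le_trans ?_ (le_csSup (bddAbove_compoundInfo h0 Δ) ⟨N, hN, rfl⟩)
      exact max_le (compoundInfo_nonneg h0 h1 hN) hlt.le
    · rw [Prod.dist_eq, dist_self, max_lt_iff]
      refine ⟨?_, hδ⟩
      rw [Real.dist_eq, abs_lt]
      have := le_max_right 0 (R - δ / 2)
      have := max_le hR (by linarith : R - δ / 2 ≤ R)
      constructor <;> linarith
  · refine closure_minimal ?_ isClosed_closure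
    rintro ⟨R, Δ⟩ ⟨hne, hR, hle⟩
    simp only at hne hR hle
    rw [capacityRegion, Metric.mem_closure_iff]
    intro δ hδ
    have hach : Achievable W Q (max 0 (R - δ / 2)) (fun s => Δ s + δ / 2) := by
      -- The truncated rate is zero in the first case, where any feasible input serves; otherwise it
      -- lies strictly below the supremum, so some feasible input beats it.
      rcases le_or_gt (R - δ / 2) 0 with h | h
      · obtain ⟨N, hN⟩ := hne
        exact achievable_of_lt h0 h1 hN (.inl (max_eq_left h)) (half_pos hδ)
      · obtain ⟨_, ⟨N, hN, rfl⟩, hlt⟩ := exists_lt_of_lt_csSup (hne.image _)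
          (lt_of_lt_of_le (by linarith : R - δ / 2 < R) hle)
        refine achievable_of_lt h0 h1 hN (.inr ?_) (half_pos hδ)
        rw [max_eq_right h.le]
        exact hlt
    refine ⟨(max 0 (R - δ / 2), fun s => Δ s + δ / 2), ⟨le_max_left _ _, hach⟩, ?_⟩
    rw [Prod.dist_eq, max_lt_iff]
    constructor
    · rw [Real.dist_eq, abs_lt]
      have := le_max_right 0 (R - δ / 2)
      have := max_le hR (by linarith : R - δ / 2 ≤ R)
      constructor <;> linarith
    · rw [dist_pi_lt_iff hδ]
      intro s
      rw [Real.dist_eq, abs_lt]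
      constructor <;> linarith
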